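/- All posets are finite, and $\log$ is the natural logarithm. **Copies and the Ramsey property.** A copy of a poset $P$ in a poset $R$ is the image of an injective map $f\colon P\to R$ such that $x\le_P y$ implies $f(x)\le_R f(y)$ (it need not be induced). For non-empty $P,Q$ write $R\to(P,Q)$ if in every colouring of the elements of $R$ with the two colours $1,2$ there is a copy of $P$ all of whose elements have colour $1$ or a copy of $Q$ all of whose elements have colour $2$; otherwise write $R\not\to(P,Q)$. Let $\mathcal P(n,p)$ be the random set of subsets of $\{1,\dots,n\}$ that contains each of the $2^n$ subsets independently with probability $p$, ordered by inclusion. The upper Ramsey exponent of $(P,Q)$ is $$c_{\mathrm{Ram}^+}(P,Q):=\inf\Bigl\{c>0:\ \lim_{n\to\infty}\mathbb P\bigl(\mathcal P(n,e^{-cn})\not\to(P,Q)\bigr)=1\Bigr\}.$$ **The critical exponent.** Let $\mathcal A(P)$ be the set of antichains of $P$, including $\emptyset$. For $X\subseteq P$ with the induced order and $S\in\mathcal A(P)$, the shadow $\partial_X S\in\mathcal A(X)$ is the set of minimal elements of $\{y\in X:\ x\le_P y\text{ for some }x\in S\}$. Let $\triangle(P)$ be the set of $\alpha\colon\mathcal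 A(P)\to[0,\infty)$ with $\sum_{S}\alpha_S=1$. For $\alpha\in\triangle(P)$ and non-empty $X\subseteq P$ put $\beta_T:=\sum_{S\in\mathcal A(P):\,\partial_X S=T}\alpha_S$ for $T\in\mathcal A(X)$ and $$c_{\alpha,P}(X):=\frac1{|X|}\sum_{T\in\mathcal A(X)}-\beta_T\log\beta_T\qquad(0\log 0:=0).$$ The critical exponent of a non-empty poset $P$ is $$c_\star(P):=\sup\bigl\{c\ge 0:\ \exists\,\alpha\in\triangle(P)\ \ \forall\,\emptyset\ne X\subseteq P:\ c\le c_{\alpha,P}(X)\bigr\}.$$ **Theorem.** Let $P,Q$ be finite posets such that $P$ has a unique maximal element $\max(P)$ and $Q$ has a unique minimal element $\min(Q)$. Let $T(P,Q)$ be the poset obtained from disjoint copies of $P$ and $Q$ by identifying $\max(P)$ with $\min(Q)$ and adding the relations $p\le q$ for all $p\in P$, $q\in Q$. Then the set in the definition of $c_{\mathrm{Ram}^+}(P,Q)$ is non-empty, and $$c_{\mathrm{Ram}^+}(P,Q)\le c_\star(T(P,Q)).$$ -/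

import Mathlib

open MeasureTheory ProbabilityTheory Filter Topology

noncomputable section

/-- The antichains of a poset `P`, the empty antichain included. -/
abbrev Antichains (P : Type*) [PartialOrder P] : Type _ :=
  {S : Set P // IsAntichain (· ≤ ·) S}

instance Antichains.instFintype (P : Type*) [PartialOrder P] [Finite P] :
    Fintype (Antichains P) :=
  Fintype.ofFinite _

/-- The upper shadow on `X ⊆ P` of an antichain `S` of `P`: the elements `y` of `X` that are
minimal in `X` with the property that `x ≤ y` for some `x ∈ S`. It is an antichain of the induced
subposet `X`. -/
def antichainShadow {P : Type*} [PartialOrder P] (X : Set P) (S : Antichains P) :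
    Antichains X :=
  ⟨{y : X | Minimal (fun z : X => ∃ x ∈ S.1, x ≤ (z : P)) y}, setOfPred_minimal_antichain _⟩

/-- The weighting of the antichains of `X ⊆ P` induced by a weighting `α` of the antichains
of `P`: the antichain `T` of `X` receives the total weight of all antichains of `P` whose shadow
on `X` is `T`. -/
def inducedWeighting {P : Type*} [PartialOrder P] [Finite P] (α : Antichains P → ℝ)
    (X : Set P) (T : Antichains X) : ℝ :=
  open Classical in ∑ S : Antichains P with antichainShadow X S = T, α S

/-- The entropy `∑ j, -β j * log (β j)`, natural logarithm, `0 * log 0 = 0`. -/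
def entropy {ι : Type*} [Fintype ι] (β : ι → ℝ) : ℝ :=
  ∑ j, Real.negMulLog (β j)

/-- The critical exponent of the subposet `X` in `P` with respect to the weighting `α`. -/
def criticalExponentOf {P : Type*} [PartialOrder P] [Finite P] (α : Antichains P → ℝ)
    (X : Set P) : ℝ :=
  entropy (inducedWeighting α X) / (X.ncard : ℝ)

/-- The critical exponent `c⋆(P)` of a finite poset `P`. -/
def cStar (P : Type*) [PartialOrder P] [Finite P] : ℝ :=
  sSup {c : ℝ | 0 ≤ c ∧ ∃ α ∈ stdSimplex ℝ (Antichains P),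
    ∀ X : Set P, X.Nonempty → c ≤ criticalExponentOf α X}

/-- The poset `R` is `(P, Q)`-Ramsey: for every colouring of `R` with two colours (`0` is the
first and `1` the second colour), there is a copy of `P` (an injective, not necessarily induced,
poset homomorphism from `P`) in the first colour or a copy of `Q` in the second colour. -/
def PosetRamsey (R P Q : Type*) [PartialOrder R] [PartialOrder P] [PartialOrder Q] : Prop :=
  ∀ χ : R → Fin 2,
    (∃ f : P →o R, Function.Injective f ∧ ∀ x, χ (f x) = 0) ∨
    (∃ g : Q →o R, Function.Injective g ∧ ∀ y, χ (g y) = 1)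

/-- The number `e^{-cn}` as a probability. For `c > 0` the number lies in `[0, 1]` and the
projection to that interval does nothing. -/
def expProb (c : ℝ) (n : ℕ) : unitInterval :=
  Set.projIcc 0 1 zero_le_one (Real.exp (-c * n))

/-- The law of the random poset `𝒫(n, p)`, `p = e^{-cn}`: the random family of subsets of an
`n`-element set that contains each subset independently with probability `p`. As a poset it
is ordered by inclusion. -/
def randomPoset (c : ℝ) (n : ℕ) : Measure (Set (Finset (Fin n))) :=
  setBernoulli Set.univ (expProb c n)

/-- The set of all `c > 0` such that with high probability, that is with probability tending
to `1` as `n → ∞`, the random poset `𝒫(n, e^{-cn})` is not `(P, Q)`-Ramsey. -/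
def nonRamseyExponents (P Q : Type*) [PartialOrder P] [PartialOrder Q] : Set ℝ :=
  {c : ℝ | 0 < c ∧
    Tendsto (fun n : ℕ => randomPoset c n {R | ¬ PosetRamsey R P Q}) atTop (𝓝 1)}

/-- The upper Ramsey exponent `c_{Ram⁺}(P, Q)`. -/
def cRamPlus (P Q : Type*) [PartialOrder P] [PartialOrder Q] : ℝ :=
  sInf (nonRamseyExponents P Q)

/-- The `Q`-on-`P` poset `T(P, Q)`, for `P` with a unique maximal and `Q` with a unique minimal
element: `P` and `Q` are stacked with every element of `P` below every element of `Q`, and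
`min Q` is identified with `max P`. Realised by leaving out the element `min Q` of `Q` (the
element `max P` of the copy of `P` plays its role) and placing the rest of `Q`
above `P` (lexicographic sum). -/
abbrev Tower (P Q : Type*) [PartialOrder P] [PartialOrder Q] : Type _ :=
  P ⊕ₗ {q : Q // ¬ IsMin q}

instance Tower.instFinite (P Q : Type*) [PartialOrder P] [PartialOrder Q] [Finite P] [Finite Q] :
    Finite (Tower P Q) :=
  inferInstanceAs (Finite (P ⊕ {q : Q // ¬ IsMin q}))

end

/-! Colour with the second colour exactly the tops of copies of `P`. No copy of `P` is then entirely
in the first colour, and a copy of `Q` in the second colour has a copy of `P` ending at its minimum,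
so the two form a tower (`not_posetRamsey_of_no_tower`). It remains to exclude towers above `cStar`
by a first moment argument. A monotone map `T → Finset (Fin n)` is a word of length `n` in the
antichains of `T`: letter `i` encodes the up-set of the points whose image contains `i`. Words are
sorted by type (empirical distribution). There are only polynomially many types, and for each type
`α` some `X ⊆ T` has exponent below `c' < c`. The restrictions to `X` of copies of type `α` number
at most `exp (n * entropy β)`, and each survives with probability `exp (-c * n) ^ |X|`, so the
expected count decays exponentially (`randomPoset_copy_of_type_le`). -/

section Combinatorics

/-- If `R` contains no copy of the tower of `P` and `Q`, then `R` is not `(P, Q)`-Ramsey: give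
the second colour to the top elements of the copies of `P`. -/
theorem not_posetRamsey_of_no_tower {R P Q : Type*} [PartialOrder R] [PartialOrder P]
    [PartialOrder Q] {a : P} (ha : ∀ p, p ≤ a) {b : Q} (hb : ∀ q, b ≤ q)
    (hR : ¬ ∃ h : Tower P Q → R, Monotone h ∧ Function.Injective h) : ¬ PosetRamsey R P Q := by
  classical
  intro hram
  obtain ⟨f, hf, hf0⟩ | ⟨g, hg, hg1⟩ := hram
    (fun x => if ∃ f : P →o R, Function.Injective f ∧ f a = x then 1 else 0)
  · have := hf0 a
    rw [if_pos ⟨f, hf, rfl⟩] at this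
    exact one_ne_zero this
  · have hx := hg1 b
    by_cases hex : ∃ f : P →o R, Function.Injective f ∧ f a = g b
    · obtain ⟨f, hf, hfg⟩ := hex
      have hle : ∀ p q, f p ≤ g q := fun p q =>
        (f.monotone (ha p)).trans (hfg.le.trans (g.monotone (hb q)))
      -- An overlap would force `g q ≤ g b`, hence `q = b`, which is minimal.
      have hne : ∀ p (q : {q : Q // ¬ IsMin q}), f p ≠ g q := by
        intro p q hpq
        have h1 : g q ≤ g b := hpq ▸ hle p b
        have h2 : (q : Q) = b := hg (le_antisymm h1 (g.monotone (hb q)))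
        exact q.2 (h2 ▸ fun y _ => hb y)
      refine hR ⟨fun t => Sum.elim f (fun q : {q : Q // ¬ IsMin q} => g q) (ofLex t), ?_, ?_⟩
      · intro s t hst
        rcases s with p | q <;> rcases t with p' | q'
        · exact f.monotone (Sum.Lex.inl_le_inl_iff.1 hst)
        · exact hle p q'
        · exact absurd hst Sum.Lex.not_inr_le_inl
        · exact g.monotone (show q ≤ q' from Sum.Lex.inr_le_inr_iff.1 hst)
      · intro s t hst
        rcases s with p | q <;> rcases t with p' | q'
        · exact congrArg _ (hf hst)
        · exact absurd hst (hne p q')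
        · exact absurd hst.symm (hne p' q)
        · exact congrArg _ (Subtype.ext (hg hst))
    · rw [if_neg hex] at hx
      exact zero_ne_one hx

end Combinatorics

/-! ### Types of words and entropy -/

section TypeClasses

/-- The empirical distribution of a word `g` of length `n`. -/
noncomputable def empirical {J : Type*} {n : ℕ} (g : Fin n → J) (j : J) : ℝ :=
  open Classical in ((Finset.univ.filter fun i => g i = j).card : ℝ) / n

theorem empirical_mem_stdSimplex {J : Type*} [Fintype J] {n : ℕ} (hn : n ≠ 0) (g : Fin n → J) :
    empirical g ∈ stdSimplex ℝ J := by
  classical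
  refine ⟨fun j => by unfold empirical; positivity, ?_⟩
  unfold empirical
  rw [← Finset.sum_div, ← Nat.cast_sum,
    ← Finset.card_eq_sum_card_fiberwise (fun i _ => Finset.mem_coe.2 (Finset.mem_univ (g i)))]
  simp [hn]

/-- A type class of words of length `n` with empirical distribution `β` has at most
`exp (n * entropy β)` elements. -/
theorem card_empirical_eq_le {J : Type*} [Fintype J] {n : ℕ} (hn : n ≠ 0) {β : J → ℝ}
    (hβ : β ∈ stdSimplex ℝ J) :
    (Nat.card {g : Fin n → J // empirical g = β} : ℝ) ≤ Real.exp (n * entropy β) := by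
  classical
  -- Under the product law of `β`, all words of type `β` have this same probability; the total mass
  -- is `1`, which bounds their number.
  have hprod : ∀ g : Fin n → J, empirical g = β →
      ∏ i, β (g i) = Real.exp (-(n * entropy β)) := by
    intro g hg
    rw [← Finset.prod_fiberwise' Finset.univ g β, entropy, Finset.mul_sum,
      ← Finset.sum_neg_distrib, Real.exp_sum]
    refine Finset.prod_congr rfl fun j _ => ?_
    rw [Finset.prod_const]
    have hj : ((Finset.univ.filter fun i => g i = j).card : ℝ) = n * β j := by
      rw [← hg, empirical]
      field_simp
    rcases (hβ.1 j).eq_or_lt with h0 | h0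
    · rw [← h0] at hj ⊢
      have : (Finset.univ.filter fun i => g i = j).card = 0 := by
        exact_mod_cast hj.trans (mul_zero _)
      simp [this]
    · rw [← Real.rpow_natCast, hj, Real.rpow_def_of_pos h0, Real.negMulLog]
      congr 1
      ring
  have hsum : ∑ g : Fin n → J, ∏ i, β (g i) = 1 := by
    rw [← Fintype.sum_pow, hβ.2, one_pow]
  have hle : ∑ g with empirical g = β, ∏ i : Fin n, β (g i) ≤ 1 := by
    rw [← hsum]
    exact Finset.sum_le_sum_of_subset_of_nonneg (Finset.subset_univ _)
      fun g _ _ => Finset.prod_nonneg fun i _ => hβ.1 _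
  rw [Finset.sum_congr rfl fun g hg => hprod g (Finset.mem_filter.1 hg).2, Finset.sum_const,
    nsmul_eq_mul, Real.exp_neg] at hle
  rw [Nat.card_eq_fintype_card, Fintype.card_subtype]
  simpa using (mul_inv_le_iff₀ (Real.exp_pos _)).1 hle

/-- A crude bound, needed only to see that the supremum defining `cStar` is over a bounded set. -/
theorem entropy_le_card {J : Type*} [Fintype J] {β : J → ℝ} (hβ : ∀ j, 0 ≤ β j) :
    entropy β ≤ Fintype.card J := by
  have : ∀ j, Real.negMulLog (β j) ≤ 1 := by
    intro j
    rcases (hβ j).eq_or_lt with h0 | h0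
    · simp [← h0]
    · have h1 := mul_le_mul_of_nonneg_left (Real.one_sub_inv_le_log_of_pos h0) h0.le
      rw [mul_sub, mul_inv_cancel₀ h0.ne'] at h1
      rw [Real.negMulLog]
      linarith
  calc entropy β ≤ ∑ _j : J, (1 : ℝ) := Finset.sum_le_sum fun j _ => this j
    _ = Fintype.card J := by simp

end TypeClasses

/-! ### Monotone maps as words in antichains -/

section Codes

variable {T : Type*} [PartialOrder T]

/-- The code of a map `f` into the subsets of `Fin n`: its `i`-th letter is the antichain of the
minimal elements of `{y | i ∈ f y}`. -/
def antichainCode {n : ℕ} (f : T → Finset (Fin n)) (i : Fin n) : Antichains T :=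
  ⟨{y | Minimal (fun z => i ∈ f z) y}, setOfPred_minimal_antichain _⟩

/-- The map with values in the subsets of `Fin n` described by a word in the antichains. -/
noncomputable def antichainDecode {n : ℕ} (g : Fin n → Antichains T) (y : T) : Finset (Fin n) :=
  open Classical in Finset.univ.filter fun i => ∃ z ∈ (g i).1, z ≤ y

theorem exists_mem_antichainCode_le [Finite T] {n : ℕ} {f : T → Finset (Fin n)} (hf : Monotone f)
    (i : Fin n) (y : T) : (∃ z ∈ (antichainCode f i).1, z ≤ y) ↔ i ∈ f y := by
  constructor
  · rintro ⟨z, hz, hzy⟩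
    exact hf hzy hz.1
  · intro hy
    obtain ⟨z, hzy, hz⟩ := exists_minimal_le_of_wellFoundedLT (fun z => i ∈ f z) y hy
    exact ⟨z, hz, hzy⟩

theorem antichainDecode_antichainCode [Finite T] {n : ℕ} {f : T → Finset (Fin n)}
    (hf : Monotone f) : antichainDecode (antichainCode f) = f := by
  ext y i
  simp only [antichainDecode, Finset.mem_filter, Finset.mem_univ, true_and]
  exact exists_mem_antichainCode_le hf i y

/-- Shadows encode restriction to `X`: the up-set generated by a letter of the code meets `X` in the
up-set of the restricted map. -/
theorem antichainShadow_antichainCode [Finite T] {n : ℕ} {f : T → Finset (Fin n)}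
    (hf : Monotone f) (X : Set T) (i : Fin n) :
    antichainShadow X (antichainCode f i) = antichainCode (fun x : X => f x) i := by
  simp only [antichainShadow, antichainCode, Subtype.mk.injEq]
  have : (fun z : X => ∃ x ∈ (antichainCode f i).1, x ≤ (z : T)) = fun z : X => i ∈ f z :=
    funext fun z => propext (exists_mem_antichainCode_le hf i z)
  exact congrArg (fun p : X → Prop => {y | Minimal p y}) this

theorem inducedWeighting_empirical [Finite T] {n : ℕ} (g : Fin n → Antichains T) (X : Set T) :
    inducedWeighting (empirical g) X = empirical fun i => antichainShadow X (g i) := by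
  classical
  ext U
  simp only [inducedWeighting, empirical]
  rw [← Finset.sum_div, ← Nat.cast_sum]
  congr 2
  rw [Finset.card_eq_sum_card_fiberwise (f := g)
    (t := Finset.univ.filter fun S => antichainShadow X S = U)]
  · refine Finset.sum_congr (by congr) fun S hS => congrArg _ ?_
    ext i
    simp only [Finset.mem_filter, Finset.mem_univ, true_and] at hS ⊢
    exact ⟨fun h => ⟨h ▸ hS, h⟩, fun h => h.2⟩
  · intro i hi
    simpa using hi

theorem inducedWeighting_mem_stdSimplex [Finite T] {α : Antichains T → ℝ}
    (hα : α ∈ stdSimplex ℝ (Antichains T)) (X : Set T) :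
    inducedWeighting α X ∈ stdSimplex ℝ (Antichains X) := by
  classical
  refine ⟨fun U => Finset.sum_nonneg fun S _ => hα.1 S, ?_⟩
  rw [← hα.2]
  unfold inducedWeighting
  rw [← Finset.sum_fiberwise Finset.univ (antichainShadow X) α]

/-- For `c` above the critical exponent, every weighting has a subposet that is sparse. -/
theorem exists_criticalExponentOf_lt [Finite T] [Nonempty T] {c : ℝ} (hc : cStar T < c)
    {α : Antichains T → ℝ} (hα : α ∈ stdSimplex ℝ (Antichains T)) :
    ∃ X : Set T, X.Nonempty ∧ criticalExponentOf α X < c := by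
  by_contra! hX
  have h0 : 0 ≤ cStar T := Real.sSup_nonneg fun x hx => hx.1
  refine hc.not_ge (le_csSup ⟨Fintype.card (Antichains (Set.univ : Set T)), ?_⟩
    ⟨h0.trans hc.le, α, hα, hX⟩)
  rintro x ⟨-, γ, hγ, hx⟩
  refine (hx Set.univ Set.univ_nonempty).trans ?_
  have hcard : (1 : ℝ) ≤ (Set.univ : Set T).ncard := by
    exact_mod_cast (Set.ncard_pos (Set.toFinite _)).2 Set.univ_nonempty
  refine (div_le_div_of_nonneg_right
    (entropy_le_card (inducedWeighting_mem_stdSimplex hγ _).1) (by positivity)).trans ?_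
  exact div_le_self (by positivity) hcard

end Codes

/-! ### First moment bounds -/

section Probability

theorem setBernoulli_univ_superset {ι : Type*} (p : unitInterval) (s : Finset ι) :
    (setBernoulli Set.univ p).real {R : Set ι | ∀ x ∈ s, x ∈ R} = (p : ℝ) ^ s.card := by
  have h : (fun q : ι → Prop => {i | q i}) ⁻¹' {R : Set ι | ∀ x ∈ s, x ∈ R} =
      (s : Set ι).pi fun _ => {True} := by
    ext q
    simp
  rw [measureReal_def, setBernoulli_apply', h, Measure.infinitePi_pi _ fun _ _ => .of_discrete]
  simp

theorem coe_expProb {c : ℝ} (hc : 0 < c) (n : ℕ) : (expProb c n : ℝ) = Real.exp (-c * n) := by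
  rw [expProb, Set.projIcc_of_mem _ ⟨(Real.exp_pos _).le, Real.exp_le_one_iff.2 (by
    have := n.cast_nonneg (α := ℝ)
    nlinarith)⟩]

instance randomPoset.instIsProbabilityMeasure (c : ℝ) (n : ℕ) :
    IsProbabilityMeasure (randomPoset c n) :=
  inferInstanceAs (IsProbabilityMeasure (setBernoulli _ _))

variable {T : Type*} [PartialOrder T]

/-- The probability that `𝒫(n, e^{-cn})` has a copy of `T` with a given type `α`, if some
subposet of `T` has an exponent less than `c'` with respect to `α`. -/
theorem randomPoset_copy_of_type_le [Finite T] {c c' : ℝ} (hc : 0 < c) (hcc : c' ≤ c) {n : ℕ}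
    (hn : n ≠ 0) {α : Antichains T → ℝ} (hα : α ∈ stdSimplex ℝ (Antichains T)) {X : Set T}
    (hX : X.Nonempty) (hXc : criticalExponentOf α X < c') :
    (randomPoset c n).real {R | ∃ f : T → Finset (Fin n), Monotone f ∧ Function.Injective f ∧
      (∀ t, f t ∈ R) ∧ empirical (antichainCode f) = α} ≤ Real.exp (-(c - c')) ^ n := by
  classical
  have := Fintype.ofFinite T
  set β := inducedWeighting α X with hβ
  let W := {g : Fin n → Antichains X // empirical g = β}
  have : Fintype W := Fintype.ofFinite W
  -- Injectivity is part of the event, so that a nonempty event asks for `X.ncard` distinct sets.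
  let E : W → Set (Set (Finset (Fin n))) := fun g =>
    {R | Function.Injective (antichainDecode g.1) ∧ ∀ x, antichainDecode g.1 x ∈ R}
  have hXpos : (1 : ℝ) ≤ X.ncard := by exact_mod_cast (Set.ncard_pos (Set.toFinite _)).2 hX
  have hE : ∀ g, (randomPoset c n).real (E g) ≤ Real.exp (-c * n) ^ X.ncard := by
    intro g
    by_cases hg : Function.Injective (antichainDecode g.1)
    · refine le_of_eq ?_
      rw [← coe_expProb hc, ← Nat.card_coe_set_eq, Nat.card_eq_fintype_card, ← Finset.card_univ,
        ← Finset.card_image_of_injective _ hg, ← setBernoulli_univ_superset, randomPoset]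
      congr 1
      ext R
      simp only [E, Set.mem_ofPred_eq, hg, true_and, Finset.forall_mem_image, Finset.mem_univ,
        true_implies]
    · have : E g = ∅ := by
        ext R
        simp [E, hg]
      rw [this, measureReal_empty]
      positivity
  have hsub : {R | ∃ f : T → Finset (Fin n), Monotone f ∧ Function.Injective f ∧
      (∀ t, f t ∈ R) ∧ empirical (antichainCode f) = α} ⊆ ⋃ g, E g := by
    rintro R ⟨f, hf, hinj, hR, hα⟩
    have hfX : Monotone fun x : X => f x := fun x y hxy => hf hxy
    refine Set.mem_iUnion.2 ⟨⟨antichainCode fun x : X => f x, ?_⟩, ?_⟩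
    · rw [hβ, ← hα, inducedWeighting_empirical]
      exact congrArg empirical (funext fun i => (antichainShadow_antichainCode hf X i).symm)
    · simp only [E, Set.mem_ofPred_eq, antichainDecode_antichainCode hfX]
      exact ⟨hinj.comp Subtype.val_injective, fun x => hR x⟩
  calc _ ≤ (randomPoset c n).real (⋃ g, E g) := measureReal_mono hsub
    _ ≤ ∑ g, (randomPoset c n).real (E g) := measureReal_iUnion_fintype_le _
    _ ≤ ∑ _g : W, Real.exp (-c * n) ^ X.ncard := Finset.sum_le_sum fun g _ => hE g
    _ = Nat.card W * Real.exp (-c * n) ^ X.ncard := by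
      rw [Finset.sum_const, Finset.card_univ, nsmul_eq_mul, Nat.card_eq_fintype_card]
    _ ≤ Real.exp (n * entropy β) * Real.exp (-c * n) ^ X.ncard := by
      gcongr
      exact card_empirical_eq_le hn (inducedWeighting_mem_stdSimplex hα X)
    _ ≤ Real.exp (-(c - c')) ^ n := by
      rw [← Real.exp_nat_mul, ← Real.exp_nat_mul, ← Real.exp_add, Real.exp_le_exp]
      have h1 : entropy β ≤ c' * X.ncard := by
        rw [criticalExponentOf, div_lt_iff₀ (by linarith)] at hXc
        exact hXc.le
      have h2 : (n : ℝ) * entropy β ≤ n * (c' * X.ncard) := by gcongr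
      -- As `X` is nonempty, the bound can be made independent of `X`.
      have h3 : (n : ℝ) * (c - c') ≤ n * (c - c') * X.ncard :=
        le_mul_of_one_le_right (mul_nonneg n.cast_nonneg (sub_nonneg.2 hcc)) hXpos
      linarith

/-- The first moment bound: above the critical exponent of `T`, the random poset has a copy
of `T` with exponentially small probability. -/
theorem randomPoset_copy_le [Finite T] [Nonempty T] {c c' : ℝ} (hc : 0 < c) (hcc : c' ≤ c)
    (hc' : cStar T < c') {n : ℕ} (hn : n ≠ 0) :
    (randomPoset c n).real {R | ∃ f : T → Finset (Fin n), Monotone f ∧ Function.Injective f ∧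
      ∀ t, f t ∈ R} ≤
    ((n + 1 : ℕ) : ℝ) ^ Fintype.card (Antichains T) * Real.exp (-(c - c')) ^ n := by
  classical
  -- Each letter occurs between `0` and `n` times. Vectors `k` that are not the counts of a word are
  -- included; if `w k` leaves the simplex, its event is empty.
  let w : (Antichains T → Fin (n + 1)) → Antichains T → ℝ := fun k S => (k S : ℕ) / n
  let E : (Antichains T → Fin (n + 1)) → Set (Set (Finset (Fin n))) := fun k =>
    {R | ∃ f : T → Finset (Fin n), Monotone f ∧ Function.Injective f ∧
      (∀ t, f t ∈ R) ∧ empirical (antichainCode f) = w k}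
  have hE : ∀ k, (randomPoset c n).real (E k) ≤ Real.exp (-(c - c')) ^ n := by
    intro k
    by_cases hk : w k ∈ stdSimplex ℝ (Antichains T)
    · obtain ⟨X, hX, hXc⟩ := exists_criticalExponentOf_lt hc' hk
      exact randomPoset_copy_of_type_le hc hcc hn hk hX hXc
    · have : E k = ∅ := by
        refine Set.eq_empty_of_forall_notMem ?_
        rintro R ⟨f, -, -, -, hf⟩
        exact hk (hf ▸ empirical_mem_stdSimplex hn _)
      rw [this, measureReal_empty]
      positivity
  have hsub : {R | ∃ f : T → Finset (Fin n), Monotone f ∧ Function.Injective f ∧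
      ∀ t, f t ∈ R} ⊆ ⋃ k, E k := by
    rintro R ⟨f, hf, hinj, hR⟩
    refine Set.mem_iUnion.2 ⟨fun S => ⟨(Finset.univ.filter fun i => antichainCode f i = S).card,
      Nat.lt_succ_of_le ((Finset.card_le_univ _).trans_eq (Fintype.card_fin n))⟩,
      f, hf, hinj, hR, ?_⟩
    ext S
    simp only [empirical, w]
    congr
  calc _ ≤ (randomPoset c n).real (⋃ k, E k) := measureReal_mono hsub
    _ ≤ ∑ k, (randomPoset c n).real (E k) := measureReal_iUnion_fintype_le _
    _ ≤ ∑ _k : Antichains T → Fin (n + 1), Real.exp (-(c - c')) ^ n :=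
      Finset.sum_le_sum fun k _ => hE k
    _ = _ := by simp

theorem tendsto_succ_pow_mul_pow (k : ℕ) {r : ℝ} (h0 : 0 < r) (h1 : r < 1) :
    Tendsto (fun n : ℕ => ((n + 1 : ℕ) : ℝ) ^ k * r ^ n) atTop (𝓝 0) := by
  have h := ((tendsto_pow_const_mul_const_pow_of_abs_lt_one k
    (by rwa [abs_of_pos h0] : |r| < 1)).comp (tendsto_add_atTop_nat 1)).mul_const r⁻¹
  rw [zero_mul] at h
  refine h.congr fun n => ?_
  simp only [Function.comp_apply, pow_succ r n]
  field_simp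

end Probability

/-- Above the critical exponent of the tower, the random poset is not Ramsey. -/
theorem mem_nonRamseyExponents {P Q : Type*} [PartialOrder P] [Finite P] [PartialOrder Q]
    [Finite Q] (hP : ∃! x : P, IsMax x) (hQ : ∃! y : Q, IsMin y) {c : ℝ}
    (hc : cStar (Tower P Q) < c) : c ∈ nonRamseyExponents P Q := by
  obtain ⟨a, -, ha'⟩ := hP
  obtain ⟨b, -, hb'⟩ := hQ
  have ha : ∀ p, p ≤ a := by
    intro p
    obtain ⟨m, hpm, hm⟩ := Finite.exists_le_maximal (p := fun _ : P => True) (a := p) trivial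
    exact ha' m (fun y hy => hm.2 trivial hy) ▸ hpm
  have hb : ∀ q, b ≤ q := by
    intro q
    obtain ⟨m, hmq, hm⟩ := exists_minimal_le_of_wellFoundedLT (fun _ : Q => True) q trivial
    exact hb' m (fun y hy => hm.2 trivial hy) ▸ hmq
  have : Nonempty (Tower P Q) := ⟨toLex (Sum.inl a)⟩
  have hpos : 0 < c := lt_of_le_of_lt (Real.sSup_nonneg fun x hx => hx.1) hc
  -- The gap `c - c'` is the exponential rate that beats the polynomial number of types.
  obtain ⟨c', hc', hcc⟩ := exists_between hc
  refine ⟨hpos, ?_⟩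
  have hlim := tendsto_succ_pow_mul_pow (Fintype.card (Antichains (Tower P Q)))
    (Real.exp_pos (-(c - c'))) (Real.exp_lt_one_iff.2 (by linarith))
  have hreal : Tendsto (fun n => (randomPoset c n).real {R | ¬ PosetRamsey R P Q}) atTop
      (𝓝 1) := by
    have hlow := (tendsto_const_nhds (x := (1 : ℝ))).sub hlim
    rw [sub_zero] at hlow
    refine tendsto_of_tendsto_of_tendsto_of_le_of_le' hlow tendsto_const_nhds ?_
      (Eventually.of_forall fun n => measureReal_le_one)
    filter_upwards [eventually_ne_atTop 0] with n hn
    have hcover : (Set.univ : Set (Set (Finset (Fin n)))) ⊆ {R | ¬ PosetRamsey R P Q} ∪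
        {R | ∃ f : Tower P Q → Finset (Fin n), Monotone f ∧ Function.Injective f ∧
          ∀ t, f t ∈ R} := by
      intro R _
      by_cases hR : ∃ h : Tower P Q → R, Monotone h ∧ Function.Injective h
      · obtain ⟨h, hm, hi⟩ := hR
        exact Or.inr ⟨fun t => h t, fun s t hst => hm hst,
          Subtype.val_injective.comp hi, fun t => (h t).2⟩
      · exact Or.inl (not_posetRamsey_of_no_tower ha hb hR)
    have h1 := (measureReal_mono (μ := randomPoset c n) hcover).trans (measureReal_union_le _ _)
    rw [probReal_univ] at h1
    linarith [randomPoset_copy_le hpos hcc.le hc' hn]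
  have h := ENNReal.tendsto_ofReal hreal
  rw [ENNReal.ofReal_one] at h
  exact h.congr fun n => ofReal_measureReal

theorem mainTheorem5 {P Q : Type*} [PartialOrder P] [Finite P] [PartialOrder Q] [Finite Q]
    (hP : ∃! x : P, IsMax x) (hQ : ∃! y : Q, IsMin y) :
    (nonRamseyExponents P Q).Nonempty ∧ cRamPlus P Q ≤ cStar (Tower P Q) :=
  ⟨⟨_, mem_nonRamseyExponents hP hQ (lt_add_one _)⟩, le_of_forall_gt_imp_ge_of_dense fun _ hc =>
    csInf_le ⟨0, fun _ h => h.1.le⟩ (mem_nonRamseyExponents hP hQ hc)⟩
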